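/- Let $E$ be a finite set, let $w\colon E\to\mathbb{R}_{>0}$ take exactly $k\ge 2$ distinct values $w_1>w_2>\dots>w_k$, and put $\alpha_w=\min_{1\le i\le k-1} w_i/w_{i+1}$. For $X\subseteq E$ write $w(X)=\sum_{e\in X}w(e)$ and $X_i=\{e\in X: w(e)=w_i\}$. A set $X\subseteq E$ is lex-larger than $Y\subseteq E$ if for some index $i$ we have $|X_j|=|Y_j|$ for all $j<i$ and $|X_i|>|Y_i|$; a member $X$ of a family $\mathcal{F}\subseteq 2^E$ is lex-maximal in $\mathcal{F}$ if no member of $\mathcal{F}$ is lex-larger than $X$. Let $\mathbf{M}_1=(E,\mathcal{I}_1)$ and $\mathbf{M}_2=(E,\mathcal{I}_2)$ be two matroids on $E$, and let $\mathcal{F}=\mathcal{I}_1\cap\mathcal{I}_2$ be the family of common independent sets. Then lex-maximal and maximum-weight members of $\mathcal{F}$ exist, and the following hold. (1) If $\alpha_w\le 2$, then every lex-maximal $X\in\mathcal{F}$ satisfies \[ w(X)\ \ge\ \frac{\alpha_w}{2}\cdot\max_{Y\in\mathcal{F}}w(Y). \] (2) If $\alpha_w>2$, then a set $X\subseteq E$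 is a lex-maximal member of $\mathcal{F}$ if and only if it is a maximum-weight member of $\mathcal{F}$. -/

import Mathlib

namespace LexMax

noncomputable section

/-- The weight `w(X)` of a subset: the sum of the weights of its elements. -/
def weight {E : Type*} (w : E → ℝ) (X : Finset E) : ℝ :=
  ∑ e ∈ X, w e

/-- The finite set of distinct values of `w`. -/
def values {E : Type*} [Fintype E] (w : E → ℝ) : Finset ℝ :=
  Finset.univ.image w

/-- The number `k` of distinct values of `w`. -/
abbrev numValues {E : Type*} [Fintype E] (w : E → ℝ) : ℕ :=
  (values w).card

/-- The distinct values `w₁ > w₂ > ⋯ > w_k` of `w` in descending order, indexed by `0, …, k - 1`: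
the increasing enumeration of the values, read backwards. -/
def value {E : Type*} [Fintype E] (w : E → ℝ) (i : Fin (numValues w)) : ℝ :=
  (values w).orderEmbOfFin rfl i.rev

/-- `α_w`, the minimum over `1 ≤ i ≤ k - 1` of the ratios `w_i / w_{i+1}` of consecutive distinct
values. It is used only for `2 ≤ k`, when this is an infimum over a nonempty finite index set. -/
def minRatio {E : Type*} [Fintype E] (w : E → ℝ) : ℝ :=
  ⨅ i : Fin (numValues w - 1),
    value w ⟨i.val, by have := i.isLt; omega⟩ / value w ⟨i.val + 1, by have := i.isLt; omega⟩

/-- `X_i`, the set of elements of `X` whose weight is the `i`-th distinct value. -/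
def layer {E : Type*} [Fintype E] (w : E → ℝ) (X : Finset E) (i : Fin (numValues w)) : Finset E :=
  X.filter (fun e => w e = value w i)

/-- `X` is lex-larger than `Y`. -/
def LexLarger {E : Type*} [Fintype E] (w : E → ℝ) (X Y : Finset E) : Prop :=
  ∃ i : Fin (numValues w),
    (∀ j : Fin (numValues w), j < i → (layer w X j).card = (layer w Y j).card) ∧
      (layer w Y i).card < (layer w X i).card

/-- `X` is a lex-maximal member of the family `F`. -/
def IsLexMaximal {E : Type*} [Fintype E] (w : E → ℝ) (F : Set (Finset E)) (X : Finset E) : Prop :=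
  X ∈ F ∧ ∀ Y ∈ F, ¬ LexLarger w Y X

/-- `X` is a maximum-weight member of the family `F`. -/
def IsMaxWeight {E : Type*} (w : E → ℝ) (F : Set (Finset E)) (X : Finset E) : Prop :=
  X ∈ F ∧ ∀ Y ∈ F, weight w Y ≤ weight w X

/-- The family of common independent sets of two matroids. -/
def commonIndep {E : Type*} (M₁ M₂ : Matroid E) : Set (Finset E) :=
  {X | M₁.Indep (X : Set E) ∧ M₂.Indep (X : Set E)}

end

end LexMax

/-! Give level `i` (levels ascend with weight) the surrogate integer weight `N ^ i` with `N` large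
and odd. A lex-maximal `X` is then a maximum-weight common independent set, and Frank's
weight-splitting theorem (`exists_weight_splitting`) writes `N ^ i = w₁ + w₂` so that `X` is optimal
in each matroid separately. Optimality in one matroid depends only on the order of the weights, so
it survives any monotone rescaling `φ` that is nonnegative and vanishes at `0`. The function
`rescale` is such a `φ`, tuned to the true level weights `v`: `φ w₁ + φ w₂` is at least `v i` on
every element of level `i` (`le_rescale_add_rescale`), and at most `max (v i) (2 * v (i - 1))` on
those of `X` (`rescale_add_rescale_le`). Comparing `Y` with `X` through `φ` loses only the ratio of
these bounds, which yields the factor `α / 2`, and no loss once `α ≥ 2`. For `α > 2` the slack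
allows one level weight to be lowered, which forces maximum-weight sets to have lex-maximal level
counts. -/

namespace Matroid

/-! ### Base exchanges in a single matroid. -/

variable {α : Type*} {M : Matroid α} {B B' : Set α} {x y z : α}

lemma IsBase.exchange_iff_mem_fundCircuit (hB : M.IsBase B) (hx : x ∈ B) (hyE : y ∈ M.E)
    (hy : y ∉ B) : M.IsBase (insert y (B \ {x})) ↔ x ∈ M.fundCircuit y B := by
  have hyx : y ≠ x := fun h => hy (h ▸ hx)
  rw [hB.indep.mem_fundCircuit_iff (by rwa [hB.closure_eq]) hy,
    ← Set.insert_sdiff_singleton_comm hyx]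
  exact ⟨fun h => h.indep, fun h => hB.exchange_isBase_of_indep hy h⟩

/-- A circuit and a cocircuit never meet in exactly one element. The fundamental circuit of `x` over
`B'` and the fundamental cocircuit of `x` for `B` share `x`, hence also some `y ≠ x`, which serves
both exchanges. -/
lemma IsBase.symmetric_exchange (hB : M.IsBase B) (hB' : M.IsBase B') (hx : x ∈ B \ B') :
    ∃ y ∈ B' \ B, M.IsBase (insert y (B \ {x})) ∧ M.IsBase (insert x (B' \ {y})) := by
  have hxE : x ∈ M.E := hB.subset_ground hx.1
  have hC := hB'.fundCircuit_isCircuit hxE hx.2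
  have hK := fundCocircuit_isCocircuit hx.1 hB
  obtain ⟨y, hy, hyx⟩ := (hC.isCocircuit_inter_nontrivial hK
    ⟨x, M.mem_fundCircuit x B', M.mem_fundCocircuit x B⟩).exists_ne x
  have hyB' : y ∈ B' := (M.fundCircuit_subset_insert x B' hy.1).resolve_left hyx
  have hyB : y ∈ M.E \ B := (M.fundCocircuit_subset_insert_compl x B hy.2).resolve_left hyx
  refine ⟨y, ⟨hyB', hyB.2⟩, ?_, ?_⟩
  · rw [hB.exchange_iff_mem_fundCircuit hx.1 hyB.1 hyB.2]
    exact hB.mem_fundCocircuit_iff_mem_fundCircuit.1 hy.2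
  · rw [hB'.exchange_iff_mem_fundCircuit hyB' hxE hx.2]
    exact hy.1

/-- The old circuit avoids `x`, so it survives inside the new base plus `z`; fundamental circuits
are unique. -/
lemma IsBase.fundCircuit_exchange_eq (hB : M.IsBase B)
    (hxy : M.IsBase (insert y (B \ {x}))) (hzE : z ∈ M.E) (hz : z ∉ B)
    (hxz : x ∉ M.fundCircuit z B) :
    M.fundCircuit z (insert y (B \ {x})) = M.fundCircuit z B := by
  refine ((hB.fundCircuit_isCircuit hzE hz).eq_fundCircuit_of_subset hxy.indep ?_).symm
  intro a ha
  obtain rfl | haB := M.fundCircuit_subset_insert z B ha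
  · exact Set.mem_insert _ _
  · exact .inr (.inr ⟨haB, fun h => hxz (h ▸ ha)⟩)

/-- A base at which no single exchange increases the weight has maximum weight. -/
lemma IsBase.sum_le_sum_of_exchange [DecidableEq α] {R : Type*} [AddCommMonoid R] [PartialOrder R]
    [IsOrderedAddMonoid R] {B B' : Finset α} (hB : M.IsBase B) (f : α → R)
    (hf : ∀ x ∈ B, ∀ y ∉ B, M.IsBase (insert y ((B : Set α) \ {x})) → f y ≤ f x)
    (hB' : M.IsBase B') : ∑ e ∈ B', f e ≤ ∑ e ∈ B, f e := by
  induction hn : (B \ B').card generalizing B' with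
  | zero =>
    have h : B ⊆ B' := Finset.sdiff_eq_empty_iff_subset.1 (Finset.card_eq_zero.1 hn)
    have := hB.eq_of_subset_isBase hB' (by exact_mod_cast h)
    rw [Finset.coe_injective this]
  | succ n ih =>
    obtain ⟨x, hx⟩ : (B \ B').Nonempty := by rw [← Finset.card_pos]; omega
    have hx' := Finset.mem_sdiff.1 hx
    obtain ⟨y, ⟨hyB', hyB⟩, h₁, h₂⟩ := hB.symmetric_exchange (x := x) hB' (by simpa using hx')
    have hyB' : y ∈ B' := hyB'
    have hyB : y ∉ B := hyB
    have hle := hf x hx'.1 y hyB h₁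
    have hxe : x ∉ B'.erase y := fun h => hx'.2 (Finset.mem_of_mem_erase h)
    -- Symmetric exchange moves `B'` one element closer to `B` without decreasing the weight.
    have key := ih (B' := insert x (B'.erase y)) (by simpa using h₂) (by
      have : B \ insert x (B'.erase y) = (B \ B').erase x := by
        ext a
        simp only [Finset.mem_sdiff, Finset.mem_insert, Finset.mem_erase]
        constructor
        · rintro ⟨haB, h⟩
          push Not at h
          exact ⟨h.1, haB, fun ha => h.2 (fun hay => hyB (hay ▸ haB)) ha⟩
        · rintro ⟨hax, haB, ha⟩
          exact ⟨haB, by simp [hax, ha]⟩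
      rw [this, Finset.card_erase_of_mem hx, hn]; rfl)
    rw [Finset.sum_insert hxe] at key
    calc ∑ e ∈ B', f e = f y + ∑ e ∈ B'.erase y, f e := (Finset.add_sum_erase _ _ hyB').symm
      _ ≤ f x + ∑ e ∈ B'.erase y, f e := by gcongr
      _ ≤ _ := key

/-- Simultaneous exchange along a matching that is triangular with respect to `r`. -/
lemma IsBase.exchange_of_triangular {ι β : Type*} [LinearOrder β] (r : ι → β) (s : Finset ι)
    (hB : M.IsBase B) (x y : ι → α) (hx : ∀ i ∈ s, x i ∈ B) (hy : ∀ i ∈ s, y i ∉ B)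
    (hxy : ∀ i ∈ s, M.IsBase (insert (y i) (B \ {x i})))
    (h : ∀ i ∈ s, ∀ j ∈ s, i ≠ j → M.IsBase (insert (y j) (B \ {x i})) → r i < r j) :
    M.IsBase ((B \ x '' s) ∪ y '' s) := by
  classical
  have hyE : ∀ i ∈ s, y i ∈ M.E := fun i hi => (hxy i hi).subset_ground (Set.mem_insert _ _)
  induction s using Finset.induction_on_max_value r generalizing B with
  | empty => simpa using hB
  | insert a s has hmax ih =>
    have ha : a ∈ insert a s := Finset.mem_insert_self a s
    have hs : ∀ i ∈ s, i ∈ insert a s := fun i hi => Finset.mem_insert_of_mem hi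
    have hne : ∀ i ∈ s, a ≠ i := fun i hi hai => has (hai ▸ hi)
    -- By maximality of `r a`, `x a` lies on no other fundamental circuit. Exchanging the pair `a`
    -- therefore leaves the other circuits unchanged, and induction applies to the new base.
    have hno : ∀ j ∈ s, x a ∉ M.fundCircuit (y j) B := fun j hj hmem =>
      (hmax j hj).not_gt (h a ha j (hs j hj) (hne j hj)
        ((hB.exchange_iff_mem_fundCircuit (hx a ha) (hyE j (hs j hj)) (hy j (hs j hj))).2 hmem))
    have hxne : ∀ i ∈ s, x i ≠ x a := fun i hi hi' =>
      hno i hi ((hB.exchange_iff_mem_fundCircuit (hx a ha) (hyE i (hs i hi)) (hy i (hs i hi))).1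
        (hi' ▸ hxy i (hs i hi)))
    have hyne : ∀ i ∈ s, y i ≠ y a := fun i hi hi' =>
      hno i hi ((hB.exchange_iff_mem_fundCircuit (hx a ha) (hyE i (hs i hi)) (hy i (hs i hi))).1
        (hi' ▸ hxy a ha))
    have hB₁ := hxy a ha
    have hxB₁ : ∀ i ∈ s, x i ∈ insert (y a) (B \ {x a}) := fun i hi =>
      .inr ⟨hx i (hs i hi), hxne i hi⟩
    have hyB₁ : ∀ i ∈ s, y i ∉ insert (y a) (B \ {x a}) := fun i hi hmem =>
      hmem.elim (hyne i hi) fun h' => hy i (hs i hi) h'.1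
    have hiff : ∀ i ∈ s, ∀ j ∈ s, M.IsBase (insert (y j) (insert (y a) (B \ {x a}) \ {x i})) ↔
        M.IsBase (insert (y j) (B \ {x i})) := fun i hi j hj => by
      have hjE := hyE j (hs j hj)
      rw [hB₁.exchange_iff_mem_fundCircuit (hxB₁ i hi) hjE (hyB₁ j hj),
        hB.exchange_iff_mem_fundCircuit (hx i (hs i hi)) hjE (hy j (hs j hj)),
        hB.fundCircuit_exchange_eq hB₁ hjE (hy j (hs j hj)) (hno j hj)]
    have key := ih hB₁ hxB₁ hyB₁ (fun i hi => (hiff i hi i hi).2 (hxy i (hs i hi)))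
      (fun i hi j hj hij hb => h i (hs i hi) j (hs j hj) hij ((hiff i hi j hj).1 hb))
      (fun i hi => hyE i (hs i hi))
    convert key using 1
    have hya : y a ∉ x '' s := by
      rintro ⟨i, hi, hi'⟩
      exact hy a ha (hi' ▸ hx i (hs i hi))
    ext b
    simp only [Finset.coe_insert, Set.image_insert_eq, Set.mem_union, Set.mem_sdiff,
      Set.mem_insert_iff, Set.mem_singleton_iff]
    by_cases hb : b = y a
    · subst hb; simp [hya]
    · tauto

end Matroid
-- Alternating walks, their gains, and potentials.
namespace LexMax

/-- A walk `x 0, y 0, x 1, y 1, …, x n` whose steps alternate between `A₁` and `A₂`. -/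
def AltWalk {α : Type*} (A₁ A₂ : α → α → Prop) (x y : ℕ → α) (n : ℕ) : Prop :=
  ∀ i < n, A₁ (x i) (y i) ∧ A₂ (x (i + 1)) (y i)

/-- The weight gained along a walk by exchanging each `x (i + 1)` for `y i`. -/
def gain {α : Type*} (ω : α → ℤ) (x y : ℕ → α) (n : ℕ) : ℤ :=
  ∑ i ∈ Finset.range n, (ω (y i) - ω (x (i + 1)))

section Walk

variable {α : Type*} {A₁ A₂ : α → α → Prop} {ω : α → ℤ} {x y : ℕ → α} {n i j : ℕ}

lemma gain_succ : gain ω x y (n + 1) = gain ω x y n + (ω (y n) - ω (x (n + 1))) :=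
  Finset.sum_range_succ _ _

/-- A chord jumping forward shortcuts a walk. -/
lemma AltWalk.shortcut (h : AltWalk A₁ A₂ x y n) (hij : i < j) (hj : j < n)
    (hc : A₁ (x i) (y j)) :
    ∃ x' y', AltWalk A₁ A₂ x' y' (n - (j - i)) ∧ x' 0 = x 0 ∧ x' (n - (j - i)) = x n ∧
      gain ω x' y' (n - (j - i)) = gain ω x y n - (gain ω x y j - gain ω x y i) := by
  obtain ⟨d, rfl⟩ := Nat.exists_eq_add_of_lt hij
  obtain ⟨m, rfl⟩ := Nat.exists_eq_add_of_lt hj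
  have e₁ : i + d + 1 - i = d + 1 := by omega
  have e₂ : i + d + 1 + m + 1 - (d + 1) = i + m + 1 := by omega
  rw [e₁, e₂]
  refine ⟨fun k => if k ≤ i then x k else x (k + (d + 1)),
    fun k => if k < i then y k else y (k + (d + 1)), ?_, by simp, ?_, ?_⟩
  · intro k hk
    rcases lt_trichotomy k i with hki | rfl | hki
    · simpa [hki, hki.le, Nat.succ_le_of_lt hki] using h k (by omega)
    · have := h (k + d + 1) (by omega)
      have e₃ : k + 1 + (d + 1) = k + d + 1 + 1 := by omega
      have e₄ : k + (d + 1) = k + d + 1 := by omega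
      simpa [e₃, e₄] using ⟨hc, this.2⟩
    · have := h (k + (d + 1)) (by omega)
      have e₃ : k + 1 + (d + 1) = k + (d + 1) + 1 := by omega
      simpa [hki.not_ge, hki.not_gt, (Nat.lt_succ_of_lt hki).not_ge, e₃,
        show ¬ (k + 1 ≤ i) by omega] using this
  · have e₃ : i + m + 1 + (d + 1) = i + d + 1 + m + 1 := by omega
    simp [show ¬ (i + m + 1 ≤ i) by omega, e₃]
  · have h₁ : ∀ k, gain ω (fun k => if k ≤ i then x k else x (k + (d + 1)))
        (fun k => if k < i then y k else y (k + (d + 1))) (i + k) =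
        gain ω x y i + (gain ω x y (i + d + 1 + k) - gain ω x y (i + d + 1)) := by
      intro k
      induction k with
      | zero =>
        simp only [add_zero, sub_self]
        refine Finset.sum_congr rfl fun l hl => ?_
        have hl := Finset.mem_range.1 hl
        simp [hl, Nat.succ_le_of_lt hl]
      | succ k ih =>
        rw [← add_assoc, ← add_assoc, gain_succ, gain_succ, ih]
        have e₃ : i + k + 1 + (d + 1) = i + d + 1 + k + 1 := by omega
        have e₄ : i + k + (d + 1) = i + d + 1 + k := by omega
        simp only [show ¬ (i + k + 1 ≤ i) by omega, show ¬ (i + k < i) by omega, if_false, e₃, e₄]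
        ring
    have := h₁ (m + 1)
    rw [← add_assoc, ← add_assoc] at this
    rw [this]; ring

/-- A chord jumping backward closes a segment of a walk. -/
lemma AltWalk.close (h : AltWalk A₁ A₂ x y n) (hij : i < j) (hj : j ≤ n)
    (hc : A₁ (x j) (y i)) :
    ∃ x' y', AltWalk A₁ A₂ x' y' (j - i) ∧ x' (j - i) = x' 0 ∧
      gain ω x' y' (j - i) = gain ω x y j - gain ω x y i := by
  obtain ⟨d, rfl⟩ := Nat.exists_eq_add_of_lt hij
  have e₁ : i + d + 1 - i = d + 1 := by omega
  rw [e₁]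
  -- The closed walk starts at `x j`, takes the chord to `y i`, and follows the old walk back to `x
  -- j`.
  refine ⟨fun k => if k = 0 then x (i + d + 1) else x (i + k), fun k => y (i + k), ?_, ?_, ?_⟩
  · intro k hk
    have := h (i + k) (by omega)
    rcases Nat.eq_zero_or_pos k with rfl | hk0
    · simpa using ⟨hc, this.2⟩
    · simpa [hk0.ne', ← add_assoc] using this
  · simp [← add_assoc]
  · have h₁ : ∀ k, gain ω (fun k => if k = 0 then x (i + d + 1) else x (i + k))
        (fun k => y (i + k)) k = gain ω x y (i + k) - gain ω x y i := by
      intro k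
      induction k with
      | zero => simp [gain]
      | succ k ih =>
        rw [gain_succ, ih, ← add_assoc, gain_succ]
        simp; ring
    rw [h₁]; rfl

/-- Reversal swaps the two relations, so facts about `A₁`-chords transfer to `A₂`-chords. -/
lemma AltWalk.reverse (h : AltWalk A₁ A₂ x y n) :
    AltWalk A₂ A₁ (fun k => x (n - k)) (fun k => y (n - 1 - k)) n := by
  intro k hk
  have := h (n - 1 - k) (by omega)
  have e : n - 1 - k + 1 = n - k := by omega
  rw [e] at this
  exact ⟨this.2, by simpa [show n - (k + 1) = n - 1 - k by omega] using this.1⟩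

lemma gain_eq_of_closed (hc : x n = x 0) :
    gain ω x y n = ∑ i ∈ Finset.range n, (ω (y i) - ω (x i)) := by
  rw [gain, Finset.sum_sub_distrib, Finset.sum_sub_distrib]
  have h₁ := Finset.sum_range_succ (fun i => ω (x i)) n
  have h₂ := Finset.sum_range_succ' (fun i => ω (x i)) n
  rw [hc] at h₁
  linarith

lemma gain_reverse (hc : x n = x 0) :
    gain ω (fun k => x (n - k)) (fun k => y (n - 1 - k)) n = gain ω x y n := by
  rw [gain_eq_of_closed hc, gain, ← Finset.sum_range_reflect]
  refine Finset.sum_congr rfl fun k hk => ?_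
  have := Finset.mem_range.1 hk
  simp [show n - 1 - (n - 1 - k) = k by omega, show n - (n - 1 - k + 1) = k by omega]

/-- In a shortest closed walk of positive gain, all chords increase the partial gain. -/
lemma AltWalk.chord_lt (h : AltWalk A₁ A₂ x y n) (hc : x n = x 0) (hpos : 0 < gain ω x y n)
    (hmin : ∀ k < n, ∀ x' y', AltWalk A₁ A₂ x' y' k → x' k = x' 0 → gain ω x' y' k ≤ 0)
    (hi : i < n) (hj : j < n) (hij : i ≠ j) (hA : A₁ (x i) (y j)) :
    toLex (gain ω x y i, -(i : ℤ)) < toLex (gain ω x y j, -(j : ℤ)) := by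
  rw [Prod.Lex.toLex_lt_toLex]
  -- A forward chord leaves a shorter closed walk of gain at most `0`, so the excised part has
  -- positive gain. A backward chord closes a segment of gain at most `0`; ties are broken by the
  -- index.
  rcases lt_or_gt_of_ne hij with hlt | hlt
  · obtain ⟨x', y', h', h0, h1, hg⟩ := h.shortcut (ω := ω) hlt hj hA
    have := hmin _ (by omega) x' y' h' (by rw [h0, h1, hc])
    exact .inl (show gain ω x y i < gain ω x y j by linarith)
  · obtain ⟨x', y', h', h1, hg⟩ := h.close (ω := ω) hlt hi.le hA
    have := hmin _ (by omega) x' y' h' h1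
    have hle : gain ω x y i ≤ gain ω x y j := by linarith
    rcases hle.lt_or_eq with hl | he
    · exact .inl hl
    · exact .inr ⟨he, by simpa using hlt⟩

/-- If no closed walk has positive gain, then there is a potential. -/
lemma exists_potential [Finite α]
    (hno : ∀ n x y, AltWalk A₁ A₂ x y n → x n = x 0 → gain ω x y n ≤ 0) :
    ∃ p : α → ℤ, ∀ a b c, A₁ a b → A₂ c b → p c + ω b ≤ p a + ω c := by
  have := Fintype.ofFinite α
  obtain ⟨K, hK⟩ : ∃ K : ℤ, 0 ≤ K ∧ ∀ a b, ω b - ω a ≤ K := by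
    refine ⟨∑ a, |ω a| + ∑ a, |ω a|, by positivity, fun a b => ?_⟩
    have h₁ := Finset.single_le_sum (f := fun a => |ω a|) (fun i _ => abs_nonneg _)
      (Finset.mem_univ a)
    have h₂ := Finset.single_le_sum (f := fun a => |ω a|) (fun i _ => abs_nonneg _)
      (Finset.mem_univ b)
    have := le_abs_self (ω b)
    have := neg_abs_le (ω a)
    linarith
  -- A long walk repeats some `x i`. Cutting out the loop, whose gain is at most `0`, shortens the
  -- walk without lowering its gain.
  have bound : ∀ n x y, AltWalk A₁ A₂ x y n → gain ω x y n ≤ Fintype.card α * K := by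
    intro n
    induction n using Nat.strong_induction_on with
    | _ n ih =>
      intro x y h
      by_cases hn : n ≤ Fintype.card α
      · calc gain ω x y n ≤ ∑ _i ∈ Finset.range n, K := Finset.sum_le_sum fun i _ => hK.2 _ _
          _ = n * K := by simp
          _ ≤ _ := by gcongr; exact hK.1
      · push Not at hn
        obtain ⟨i, j, hne, hxy⟩ := Fintype.exists_ne_map_eq_of_card_lt
          (fun i : Fin (Fintype.card α + 1) => x i) (by simp)
        wlog hlt : i < j generalizing i j
        · exact this j i hne.symm hxy.symm (lt_of_le_of_ne (not_lt.1 hlt) hne.symm)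
        have hij : (i : ℕ) < j := hlt
        have hjn : (j : ℕ) < n := by have := j.isLt; omega
        obtain ⟨x₁, y₁, h₁, hc₁, hg₁⟩ := h.close (ω := ω) hij hjn.le
          (hxy ▸ (h i (hij.trans hjn)).1)
        obtain ⟨x₂, y₂, h₂, -, -, hg₂⟩ := h.shortcut (ω := ω) hij hjn (hxy ▸ (h j hjn).1)
        have := hno _ _ _ h₁ hc₁
        have := ih _ (by omega) _ _ h₂
        linarith
  have hex : ∀ c, ∃ g : ℤ, (∃ n x y, AltWalk A₁ A₂ x y n ∧ x n = c ∧ gain ω x y n = g) ∧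
      ∀ g', (∃ n x y, AltWalk A₁ A₂ x y n ∧ x n = c ∧ gain ω x y n = g') → g' ≤ g := fun c =>
    Int.exists_greatest_of_bdd ⟨Fintype.card α * K, by
      rintro _ ⟨n, x, y, h, -, rfl⟩; exact bound n x y h⟩
      ⟨0, 0, fun _ => c, fun _ => c, fun _ h => absurd h (Nat.not_lt_zero _), rfl, by simp [gain]⟩
  choose g hg hmax using hex
  -- The potential is minus the largest gain of a walk ending at `c`; appending one step gives the
  -- inequality.
  refine ⟨fun c => -g c, fun a b c hab hcb => ?_⟩
  obtain ⟨n, x, y, h, hx, hgn⟩ := hg a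
  have hle := hmax c (g a + (ω b - ω c)) ⟨n + 1, fun k => if k ≤ n then x k else c,
    fun k => if k < n then y k else b, ?_, by simp, ?_⟩
  · simp only; linarith
  · intro k hk
    rcases (Nat.lt_succ_iff.1 hk).lt_or_eq with hkn | rfl
    · simpa [hkn, hkn.le, Nat.succ_le_of_lt hkn] using h k hkn
    · simpa [hx] using ⟨hab, hcb⟩
  · rw [gain_succ, ← hgn]
    congr 1
    · refine Finset.sum_congr rfl fun k hk => ?_
      have hk := Finset.mem_range.1 hk
      simp [hk, Nat.succ_le_of_lt hk]
    · simp

end Walk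

end LexMax
-- Weight splitting for common bases and common independent sets.
namespace LexMax

section Splitting

variable {α : Type*} [Finite α]

/-- If `B` is a common base of maximum weight, then the weight splits into two parts for which no
single exchange improves `B` in the respective matroid. -/
theorem exists_weight_splitting_isBase [DecidableEq α] {M₁ M₂ : Matroid α} {B : Finset α}
    (ω : α → ℤ) (hB₁ : M₁.IsBase B) (hB₂ : M₂.IsBase B)
    (hmax : ∀ B' : Finset α, M₁.IsBase B' → M₂.IsBase B' → ∑ e ∈ B', ω e ≤ ∑ e ∈ B, ω e) :
    ∃ w₁ w₂ : α → ℤ, (∀ e, w₁ e + w₂ e = ω e) ∧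
      (∀ x ∈ B, ∀ y ∉ B, M₁.IsBase (insert y ((B : Set α) \ {x})) → w₁ y ≤ w₁ x) ∧
      (∀ x ∈ B, ∀ y ∉ B, M₂.IsBase (insert y ((B : Set α) \ {x})) → w₂ y ≤ w₂ x) := by
  let A (M : Matroid α) (x y : α) : Prop :=
    x ∈ B ∧ y ∉ B ∧ M.IsBase (insert y ((B : Set α) \ {x}))
  have hno : ∀ n x y, AltWalk (A M₁) (A M₂) x y n → x n = x 0 → gain ω x y n ≤ 0 := by
    by_contra! hcon
    let P : ℕ → Prop := fun n => ∃ x y, AltWalk (A M₁) (A M₂) x y n ∧ x n = x 0 ∧ 0 < gain ω x y n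
    have hP : ∃ n, P n := hcon
    classical
    -- In a shortest closed walk of positive gain the chords are triangular for both matroids, so
    -- exchanging along the whole walk yields a heavier common base.
    obtain ⟨x, y, h, hc, hpos⟩ := Nat.find_spec hP
    have hmin := fun k (hk : k < Nat.find hP) => Nat.find_min hP hk
    generalize Nat.find hP = n at h hc hpos hmin
    have hmin₁ : ∀ k < n, ∀ x' y', AltWalk (A M₁) (A M₂) x' y' k → x' k = x' 0 →
        gain ω x' y' k ≤ 0 := fun k hk x' y' h' hc' =>
      not_lt.1 fun hlt => hmin k hk ⟨x', y', h', hc', hlt⟩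
    have hmin₂ : ∀ k < n, ∀ x' y', AltWalk (A M₂) (A M₁) x' y' k → x' k = x' 0 →
        gain ω x' y' k ≤ 0 := fun k hk x' y' h' hc' => by
      rw [← gain_reverse hc']
      exact hmin₁ k hk _ _ h'.reverse (by simpa using hc'.symm)
    have hlt := fun i j hi hj hij => h.chord_lt hc hpos hmin₁ (i := i) (j := j) hi hj hij
    have hlt' := fun i j hi hj hij => h.reverse.chord_lt (by simpa using hc.symm)
      (by rwa [gain_reverse hc]) hmin₂ (i := i) (j := j) hi hj hij
    have hxinj : ∀ i < n, ∀ j < n, x i = x j → i = j := fun i hi j hj hxx => by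
      by_contra hij
      exact lt_asymm (hlt i j hi hj hij (hxx ▸ (h j hj).1))
        (hlt j i hj hi (Ne.symm hij) (hxx ▸ (h i hi).1))
    have hyinj : ∀ i < n, ∀ j < n, y i = y j → i = j := fun i hi j hj hyy => by
      by_contra hij
      exact lt_asymm (hlt i j hi hj hij (hyy ▸ (h i hi).1))
        (hlt j i hj hi (Ne.symm hij) (hyy ▸ (h j hj).1))
    have hx : ∀ i < n, x i ∈ B := fun i hi => (h i hi).1.1
    have hy : ∀ i < n, y i ∉ B := fun i hi => (h i hi).1.2.1
    let S := (Finset.range n).image x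
    let T := (Finset.range n).image y
    have hSB : S ⊆ B := by
      intro a ha
      obtain ⟨i, hi, rfl⟩ := Finset.mem_image.1 ha
      exact hx i (Finset.mem_range.1 hi)
    have hTB : Disjoint (B \ S) T := by
      rw [Finset.disjoint_right]
      intro a ha haB
      obtain ⟨i, hi, rfl⟩ := Finset.mem_image.1 ha
      exact hy i (Finset.mem_range.1 hi) (Finset.mem_sdiff.1 haB).1
    have hB₁' : M₁.IsBase ((B \ S) ∪ T : Finset α) := by
      have := hB₁.exchange_of_triangular (fun i => toLex (gain ω x y i, -(i : ℤ)))
        (Finset.range n) x y (fun i hi => hx i (Finset.mem_range.1 hi))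
        (fun i hi => hy i (Finset.mem_range.1 hi))
        (fun i hi => (h i (Finset.mem_range.1 hi)).1.2.2)
        (fun i hi j hj hij hb => hlt i j (Finset.mem_range.1 hi) (Finset.mem_range.1 hj) hij
          ⟨hx i (Finset.mem_range.1 hi), hy j (Finset.mem_range.1 hj), hb⟩)
      simpa [S, T] using this
    have hB₂' : M₂.IsBase ((B \ S) ∪ T : Finset α) := by
      have hr := h.reverse
      have := hB₂.exchange_of_triangular
        (fun i => toLex (gain ω (fun k => x (n - k)) (fun k => y (n - 1 - k)) i, -(i : ℤ)))
        (Finset.range n) (fun k => x (n - k)) (fun k => y (n - 1 - k))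
        (fun i hi => (hr i (Finset.mem_range.1 hi)).1.1)
        (fun i hi => (hr i (Finset.mem_range.1 hi)).1.2.1)
        (fun i hi => (hr i (Finset.mem_range.1 hi)).1.2.2)
        (fun i hi j hj hij hb => hlt' i j (Finset.mem_range.1 hi) (Finset.mem_range.1 hj) hij
          ⟨(hr i (Finset.mem_range.1 hi)).1.1, (hr j (Finset.mem_range.1 hj)).1.2.1, hb⟩)
      convert this using 1
      -- The reversed walk lists `x n, …, x 1`, the same set because `x n = x 0`.
      have hS : (S : Set α) = (fun k => x (n - k)) '' (Finset.range n : Finset ℕ) := by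
        ext a
        simp only [S, Finset.coe_image, Set.mem_image, Finset.coe_range, Set.mem_Iio]
        constructor
        · rintro ⟨i, hi, rfl⟩
          rcases Nat.eq_zero_or_pos i with rfl | hi0
          · exact ⟨0, hi, by simpa using hc⟩
          · exact ⟨n - i, by omega, by rw [show n - (n - i) = i by omega]⟩
        · rintro ⟨i, hi, rfl⟩
          rcases Nat.eq_zero_or_pos i with rfl | hi0
          · exact ⟨0, hi, by simpa using hc.symm⟩
          · exact ⟨n - i, by omega, rfl⟩
      have hT : (T : Set α) = (fun k => y (n - 1 - k)) '' (Finset.range n : Finset ℕ) := by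
        ext a
        simp only [T, Finset.coe_image, Set.mem_image, Finset.coe_range, Set.mem_Iio]
        constructor
        · rintro ⟨i, hi, rfl⟩
          exact ⟨n - 1 - i, by omega, by rw [show n - 1 - (n - 1 - i) = i by omega]⟩
        · rintro ⟨i, hi, rfl⟩
          exact ⟨n - 1 - i, by omega, rfl⟩
      rw [← hS, ← hT]
      simp
    have hle := hmax _ hB₁' hB₂'
    rw [Finset.sum_union hTB] at hle
    have h₁ : ∑ e ∈ B \ S, ω e + ∑ e ∈ S, ω e = ∑ e ∈ B, ω e := Finset.sum_sdiff hSB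
    have h₂ : ∑ e ∈ S, ω e = ∑ i ∈ Finset.range n, ω (x i) :=
      Finset.sum_image fun i hi j hj hij =>
        hxinj i (Finset.mem_range.1 hi) j (Finset.mem_range.1 hj) hij
    have h₃ : ∑ e ∈ T, ω e = ∑ i ∈ Finset.range n, ω (y i) :=
      Finset.sum_image fun i hi j hj hij =>
        hyinj i (Finset.mem_range.1 hi) j (Finset.mem_range.1 hj) hij
    rw [gain_eq_of_closed hc, Finset.sum_sub_distrib] at hpos
    linarith
  obtain ⟨p, hp⟩ := exists_potential hno
  -- The first part of the weight is `p` on `B`. Off `B` it is the least `p` over the `M₁`-exchange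
  -- partners, where the potential inequality gives the `M₂` bound, or any large constant if there
  -- are none.
  have hex : ∀ e, ∃ c : ℤ, (e ∈ B → c = p e) ∧ (∀ x, A M₁ x e → c ≤ p x) ∧
      ∀ z, A M₂ z e → p z + ω e ≤ c + ω z := by
    intro e
    by_cases he : e ∈ B
    · exact ⟨p e, fun _ => rfl, fun x h => absurd he h.2.1, fun z h => absurd he h.2.1⟩
    by_cases hne : ∃ x, A M₁ x e
    · obtain ⟨x, hx, hxmin⟩ := Set.exists_min_image {x | A M₁ x e} p (Set.toFinite _) hne
      exact ⟨p x, fun h => absurd h he, hxmin, fun z hz => hp x e z hx hz⟩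
    push Not at hne
    obtain ⟨K, hK⟩ := (Set.finite_range fun z => p z + ω e - ω z).bddAbove
    exact ⟨K, fun h => absurd h he, fun x hx => absurd hx (hne x), fun z _ => by
      have : p z + ω e - ω z ≤ K := hK ⟨z, rfl⟩
      linarith⟩
  choose q hqB hq₁ hq₂ using hex
  refine ⟨q, fun e => ω e - q e, fun e => by ring, fun x hx y hy hb => ?_, fun x hx y hy hb => ?_⟩
  · rw [hqB x hx]
    exact hq₁ y x ⟨hx, hy, hb⟩
  · have := hq₂ y x ⟨hx, hy, hb⟩
    rw [← hqB x hx] at this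
    simp only
    linarith

/-- The truncation to rank at most `r` of the direct sum of `M` with the free matroid on `δ`. -/
def pad (M : Matroid α) (δ : Type*) [Finite δ] (r : ℕ) : Matroid (α ⊕ δ) :=
  (IndepMatroid.ofFinite (E := Set.univ) Set.finite_univ
    (fun I => M.Indep (Sum.inl ⁻¹' I) ∧ I.ncard ≤ r)
    (by simp)
    (fun I J hJ hIJ => ⟨hJ.1.subset (Set.preimage_mono hIJ),
      (Set.ncard_le_ncard hIJ (Set.toFinite J)).trans hJ.2⟩)
    (by
      intro I J hI hJ hlt
      by_cases hd : ∃ d : δ, Sum.inr d ∈ J ∧ Sum.inr d ∉ I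
      · obtain ⟨d, hdJ, hdI⟩ := hd
        refine ⟨_, hdJ, hdI, ?_, ?_⟩
        · have : Sum.inl ⁻¹' (insert (Sum.inr d) I) = (Sum.inl ⁻¹' I : Set α) := by
            ext; simp
          rw [this]
          exact hI.1
        · have := Set.ncard_insert_le (Sum.inr d) I
          have := hJ.2
          omega
      · push Not at hd
        have hcard : ∀ K : Set (α ⊕ δ),
            K.ncard = (Sum.inl ⁻¹' K : Set α).ncard + (Sum.inr ⁻¹' K : Set δ).ncard := by
          intro K
          rw [← Set.ncard_image_of_injective (Sum.inl ⁻¹' K) (Sum.inl_injective (β := δ)),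
            ← Set.ncard_image_of_injective (Sum.inr ⁻¹' K) (Sum.inr_injective (α := α)),
            ← Set.ncard_union_eq _ (Set.toFinite _) (Set.toFinite _),
            Set.image_preimage_inl_union_image_preimage_inr]
          rw [Set.disjoint_left]
          rintro _ ⟨a, _, rfl⟩ ⟨b, _, hb⟩
          cases hb
        have hr : (Sum.inr ⁻¹' J : Set δ).ncard ≤ (Sum.inr ⁻¹' I : Set δ).ncard :=
          Set.ncard_le_ncard hd (Set.toFinite _)
        have h₁ := hcard I
        have h₂ := hcard J
        have hl : (Sum.inl ⁻¹' I : Set α).ncard < (Sum.inl ⁻¹' J : Set α).ncard := by omega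
        obtain ⟨e, he, hins⟩ := hI.1.augment hJ.1 (by
          rwa [← (Set.toFinite _).cast_ncard_eq, ← (Set.toFinite _).cast_ncard_eq, Nat.cast_lt])
        refine ⟨Sum.inl e, he.1, he.2, ?_, ?_⟩
        · have : Sum.inl ⁻¹' (insert (Sum.inl e : α ⊕ δ) I) = (insert e (Sum.inl ⁻¹' I) : Set α) := by
            ext; simp
          rwa [this]
        · have := Set.ncard_insert_le (Sum.inl e) I
          have := hJ.2
          omega)
    (fun _ _ => Set.subset_univ _)).matroid

lemma pad_indep_iff {M : Matroid α} {δ : Type*} [Finite δ] {r : ℕ} {I : Set (α ⊕ δ)} :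
    (pad M δ r).Indep I ↔ M.Indep (Sum.inl ⁻¹' I) ∧ I.ncard ≤ r := Iff.rfl

lemma pad_isBase_of_ncard {M : Matroid α} {δ : Type*} [Finite δ] {r : ℕ} {I : Set (α ⊕ δ)}
    (hI : M.Indep (Sum.inl ⁻¹' I)) (hr : I.ncard = r) : (pad M δ r).IsBase I := by
  refine (pad_indep_iff.2 ⟨hI, hr.le⟩).isBase_of_maximal fun J hJ hIJ => ?_
  exact Set.eq_of_subset_of_ncard_le hIJ (by rw [hr]; exact (pad_indep_iff.1 hJ).2) (Set.toFinite J)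

/-- Weight splitting for a common independent set `X` of maximum weight: `X` stays a maximum-weight
independent set of each matroid under every monotone rescaling of the respective part. -/
theorem exists_weight_splitting {M₁ M₂ : Matroid α} {X : Finset α} (ω : α → ℤ)
    (hX : X ∈ commonIndep M₁ M₂)
    (hmax : ∀ Y ∈ commonIndep M₁ M₂, ∑ e ∈ Y, ω e ≤ ∑ e ∈ X, ω e) :
    ∃ w₁ w₂ : α → ℤ, (∀ e, w₁ e + w₂ e = ω e) ∧ (∀ x ∈ X, 0 ≤ w₁ x ∧ 0 ≤ w₂ x) ∧
      ∀ f : ℤ → ℝ, Monotone f → f 0 = 0 → (∀ u, 0 ≤ f u) → ∀ Y ∈ commonIndep M₁ M₂,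
        ∑ e ∈ Y, f (w₁ e) ≤ ∑ e ∈ X, f (w₁ e) ∧ ∑ e ∈ Y, f (w₂ e) ≤ ∑ e ∈ X, f (w₂ e) := by
  classical
  have := Fintype.ofFinite α
  set n := Fintype.card α with hn
  -- Dummies of weight `0` fill `X` up to a base of size `n + 1`. Since `X.card ≤ n`, some dummy
  -- `d₀` is in the base, and with `n + 2` dummies some `d'` is outside it.
  let δ := Fin (n + 2)
  have hXn : X.card ≤ n := Finset.card_le_univ X
  obtain ⟨T, -, hT⟩ := Finset.exists_subset_card_eq
    (show n + 1 - X.card ≤ (Finset.univ : Finset δ).card by simp [δ]; omega)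
  obtain ⟨d₀, hd₀⟩ : T.Nonempty := by rw [← Finset.card_pos]; omega
  obtain ⟨d', hd'⟩ : ∃ d', d' ∉ T := by
    by_contra! h
    have h₁ : (Finset.univ : Finset δ).card ≤ T.card := Finset.card_le_card fun d _ => h d
    simp [δ] at h₁
    omega
  let B : Finset (α ⊕ δ) := X.disjSum T
  have hpre : ∀ Y : Finset α, ∀ S : Finset δ,
      Sum.inl ⁻¹' ((Y.disjSum S : Finset (α ⊕ δ)) : Set (α ⊕ δ)) = (Y : Set α) := by
    intro Y S; ext; simp
  have hBcard : (B : Set (α ⊕ δ)).ncard = n + 1 := by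
    rw [Set.ncard_coe_finset, Finset.card_disjSum, hT]; omega
  have hbase : ∀ M : Matroid α, M.Indep X → (pad M δ (n + 1)).IsBase B := fun M hM =>
    pad_isBase_of_ncard (by rw [hpre]; exact hM) hBcard
  have hsum : ∀ C : Finset (α ⊕ δ), ∑ e ∈ C, Sum.elim ω (fun _ => 0) e =
      ∑ e ∈ C.toLeft, ω e := by
    intro C
    conv_lhs => rw [← Finset.toLeft_disjSum_toRight (u := C)]
    simp [Finset.sum_disjSum]
  have hleft : ∀ M : Matroid α, ∀ C : Finset (α ⊕ δ), (pad M δ (n + 1)).IsBase C →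
      M.Indep (C.toLeft : Set α) := fun M C hC => by
    have := (pad_indep_iff.1 hC.indep).1
    convert this using 1
    ext; simp
  obtain ⟨w₁, w₂, hw, h₁, h₂⟩ := exists_weight_splitting_isBase (Sum.elim ω fun _ : δ => 0)
    (hbase M₁ hX.1) (hbase M₂ hX.2) (fun C hC₁ hC₂ => by
      rw [hsum, hsum]
      simpa [B] using hmax C.toLeft ⟨hleft M₁ C hC₁, hleft M₂ C hC₂⟩)
  have hd'B : Sum.inr d' ∉ B := by simpa [B] using hd'
  have hexch : ∀ M : Matroid α, M.Indep X → ∀ x ∈ B,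
      (pad M δ (n + 1)).IsBase (insert (Sum.inr d') ((B : Set (α ⊕ δ)) \ {x})) := by
    intro M hM x hx
    refine pad_isBase_of_ncard (hM.subset fun a ha => ?_) ?_
    · have : Sum.inl a ∈ B := by
        simpa using (Set.mem_of_mem_insert_of_ne ha (by simp)).1
      simpa [B] using this
    · rw [Set.ncard_exchange (by simpa using hd'B) (by simpa using hx), hBcard]
  -- The dummy `d'` can replace any element of `B` in either matroid, and its two weights sum to
  -- `0`.
  have hcross : ∀ x ∈ B, ∀ z ∈ B, 0 ≤ w₁ x + w₂ z := fun x hx z hz => by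
    have e₁ := h₁ x hx _ hd'B (hexch M₁ hX.1 x hx)
    have e₂ := h₂ z hz _ hd'B (hexch M₂ hX.2 z hz)
    have e₃ := hw (Sum.inr d')
    simp only [Sum.elim_inr] at e₃
    linarith
  have hTB : ∀ d ∈ T, Sum.inr d ∈ B := fun d hd => by simpa [B] using hd
  have hXB : ∀ x ∈ X, Sum.inl x ∈ B := fun x hx => by simpa [B] using hx
  have hd0 : ∀ d : δ, w₁ (Sum.inr d) + w₂ (Sum.inr d) = 0 := fun d => hw (Sum.inr d)
  -- `hcross` applied to pairs of dummies makes `w₁` constant on `T`. Shifting by `c` gives these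
  -- dummies weight `0` in both parts.
  set c := w₁ (Sum.inr d₀) with hcdef
  have hc₂ : w₂ (Sum.inr d₀) = -c := by linarith [hd0 d₀]
  have hT₁ : ∀ d ∈ T, w₁ (Sum.inr d) = c := fun d hd => by
    have := hcross _ (hTB d hd) _ (hTB d₀ hd₀)
    have := hcross _ (hTB d₀ hd₀) _ (hTB d hd)
    linarith [hd0 d]
  have hT₂ : ∀ d ∈ T, w₂ (Sum.inr d) = -c := fun d hd => by linarith [hd0 d, hT₁ d hd]
  have hmain : ∀ (M : Matroid α) (w : α ⊕ δ → ℤ) (t : ℤ), M.Indep X →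
      (∀ x ∈ B, ∀ y ∉ B, (pad M δ (n + 1)).IsBase (insert y ((B : Set (α ⊕ δ)) \ {x})) →
        w y ≤ w x) → (∀ d ∈ T, w (Sum.inr d) = t) →
      ∀ f : ℤ → ℝ, Monotone f → f 0 = 0 → (∀ u, 0 ≤ f u) → ∀ Y : Finset α, M.Indep Y →
        ∑ e ∈ Y, f (w (Sum.inl e) - t) ≤ ∑ e ∈ X, f (w (Sum.inl e) - t) := by
    intro M w t hM hloc hwT f hf hf0 hfn Y hY
    have hYind : (pad M δ (n + 1)).Indep (Y.disjSum (∅ : Finset δ) : Finset (α ⊕ δ)) := by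
      rw [pad_indep_iff, hpre, Set.ncard_coe_finset, Finset.card_disjSum]
      have : Y.card ≤ n := Finset.card_le_univ Y
      exact ⟨hY, by simp; omega⟩
    obtain ⟨C, hC, hYC⟩ := hYind.exists_isBase_superset
    lift C to Finset (α ⊕ δ) using Set.toFinite C
    -- Monotonicity of `f` preserves the exchange inequalities; `0 ≤ f` allows `Y` to grow to a
    -- base, and `f 0 = 0` removes the dummies of `B`.
    have key := (hbase M hM).sum_le_sum_of_exchange (fun e => f (w e - t))
      (fun x hx y hy hb => hf (by linarith [hloc x hx y hy hb])) hC
    have hTsum : ∑ d ∈ T, f (w (Sum.inr d) - t) = 0 :=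
      Finset.sum_eq_zero fun d hd => by rw [hwT d hd, sub_self, hf0]
    calc ∑ e ∈ Y, f (w (Sum.inl e) - t)
        = ∑ e ∈ Y.disjSum (∅ : Finset δ), f (w e - t) := by simp
      _ ≤ ∑ e ∈ C, f (w e - t) :=
          Finset.sum_le_sum_of_subset_of_nonneg (by exact_mod_cast hYC) fun e _ _ => hfn _
      _ ≤ ∑ e ∈ B, f (w e - t) := key
      _ = _ := by rw [Finset.sum_disjSum, hTsum, add_zero]
  refine ⟨fun e => w₁ (Sum.inl e) - c, fun e => w₂ (Sum.inl e) - -c, fun e => ?_, fun x hx => ?_,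
    fun f hf hf0 hfn Y hY => ⟨?_, ?_⟩⟩
  · have := hw (Sum.inl e)
    simp only [Sum.elim_inl] at this
    linarith
  · have e₁ := hcross _ (hXB x hx) _ (hTB d₀ hd₀)
    have e₂ := hcross _ (hTB d₀ hd₀) _ (hXB x hx)
    constructor <;> linarith
  · exact hmain M₁ w₁ c hX.1 h₁ hT₁ f hf hf0 hfn Y hY.1
  · exact hmain M₂ w₂ (-c) hX.2 h₂ hT₂ f hf hf0 hfn Y hY.2

end Splitting

end LexMax
-- The monotone rescaling function.
namespace LexMax

/-- A monotone map `ℤ → ℝ` carrying weights with unit `b i` at level `i` to weights with unit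
`v i` at level `i`, for levels up to `ℓ`. -/
noncomputable def rescale (b : ℕ → ℤ) (v : ℕ → ℝ) : ℕ → ℤ → ℝ
  | 0, _ => 0
  -- Past half of `b (ℓ + 1)` the value complements that of the mirror point `b (ℓ + 1) - u`; the
  -- floor `v ℓ` keeps the map monotone.
  | ℓ + 1, u =>
    if b (ℓ + 1) ≤ u then v (ℓ + 1)
    else if b (ℓ + 1) < 2 * u then max (v ℓ) (v (ℓ + 1) - rescale b v ℓ (b (ℓ + 1) - u))
    else rescale b v ℓ u

section Rescale

variable {b : ℕ → ℤ} {v : ℕ → ℝ} {k ℓ i : ℕ} {s t u : ℤ}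

lemma rescale_of_le (h : b (ℓ + 1) ≤ u) : rescale b v (ℓ + 1) u = v (ℓ + 1) := by
  rw [rescale, if_pos h]

lemma rescale_of_lt_two_mul (h : u < b (ℓ + 1)) (h' : b (ℓ + 1) < 2 * u) :
    rescale b v (ℓ + 1) u = max (v ℓ) (v (ℓ + 1) - rescale b v ℓ (b (ℓ + 1) - u)) := by
  rw [rescale, if_neg h.not_ge, if_pos h']

lemma rescale_of_two_mul_le (hb : 0 < b (ℓ + 1)) (h : 2 * u ≤ b (ℓ + 1)) :
    rescale b v (ℓ + 1) u = rescale b v ℓ u := by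
  rw [rescale, if_neg (by omega), if_neg (by omega)]

lemma rescale_of_nonpos (hb : ∀ i, 0 < b i) (hu : u ≤ 0) : rescale b v ℓ u = 0 := by
  induction ℓ with
  | zero => rfl
  | succ ℓ ih =>
    have := hb (ℓ + 1)
    rw [rescale_of_two_mul_le this (by omega), ih]

lemma rescale_bounds (hb : ∀ i, 0 < b i) (hv0 : v 0 = 0) (hv : ∀ i < k, v i ≤ v (i + 1))
    (hℓ : ℓ ≤ k) (u : ℤ) : 0 ≤ rescale b v ℓ u ∧ rescale b v ℓ u ≤ v ℓ := by
  induction ℓ generalizing u with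
  | zero => simp [rescale, hv0]
  | succ ℓ ih =>
    have ih := ih (by omega)
    have hle := hv ℓ (by omega)
    have hvℓ : 0 ≤ v ℓ := (ih 0).1.trans (ih 0).2
    rcases le_or_gt (b (ℓ + 1)) u with h | h
    · rw [rescale_of_le h]
      exact ⟨hvℓ.trans hle, le_rfl⟩
    rcases lt_or_ge (b (ℓ + 1)) (2 * u) with h' | h'
    · rw [rescale_of_lt_two_mul h h']
      exact ⟨le_max_of_le_left hvℓ, max_le hle (by linarith [(ih (b (ℓ + 1) - u)).1])⟩
    · rw [rescale_of_two_mul_le (hb _) h']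
      exact ⟨(ih u).1, (ih u).2.trans hle⟩

lemma rescale_mono (hb : ∀ i, 0 < b i) (hv0 : v 0 = 0) (hv : ∀ i < k, v i ≤ v (i + 1))
    (hℓ : ℓ ≤ k) : Monotone (rescale b v ℓ) := by
  induction ℓ with
  | zero => exact fun _ _ _ => le_rfl
  | succ ℓ ih =>
    have ih := ih (by omega)
    intro s t hst
    rcases le_or_gt (b (ℓ + 1)) t with h | h
    · rw [rescale_of_le h]
      exact (rescale_bounds hb hv0 hv hℓ s).2
    rcases lt_or_ge (b (ℓ + 1)) (2 * s) with hs | hs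
    · rw [rescale_of_lt_two_mul (by omega) hs, rescale_of_lt_two_mul h (by omega)]
      have := ih (show b (ℓ + 1) - t ≤ b (ℓ + 1) - s by omega)
      gcongr
    rw [rescale_of_two_mul_le (hb _) hs]
    rcases lt_or_ge (b (ℓ + 1)) (2 * t) with ht | ht
    · rw [rescale_of_lt_two_mul h ht]
      exact le_max_of_le_left (rescale_bounds hb hv0 hv (by omega) s).2
    · rw [rescale_of_two_mul_le (hb _) ht]
      exact ih hst

lemma rescale_le_succ (hb : ∀ i, 0 < b i) (hv0 : v 0 = 0) (hv : ∀ i < k, v i ≤ v (i + 1))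
    (hℓ : ℓ < k) (u : ℤ) : rescale b v ℓ u ≤ rescale b v (ℓ + 1) u := by
  have := (rescale_bounds hb hv0 hv hℓ.le u).2
  rcases le_or_gt (b (ℓ + 1)) u with h | h
  · rw [rescale_of_le h]
    exact this.trans (hv ℓ hℓ)
  rcases lt_or_ge (b (ℓ + 1)) (2 * u) with h' | h'
  · rw [rescale_of_lt_two_mul h h']
    exact le_max_of_le_left this
  · rw [rescale_of_two_mul_le (hb _) h']

/-- At the top level, oddness puts the larger of `s`, `t` strictly past half. If the other is not
past half, it is at least the mirror point and monotonicity suffices; if it is, the floor `v ℓ` pays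
for the mirror term. Lower levels follow since `rescale` grows with `ℓ`. -/
lemma le_rescale_add_rescale (hb : ∀ i, 0 < b i) (hodd : ∀ i, Odd (b i)) (hv0 : v 0 = 0)
    (hv : ∀ i < k, v i ≤ v (i + 1)) (hℓ : ℓ ≤ k) (hi : i ≤ ℓ) (hst : b i ≤ s + t) :
    v i ≤ rescale b v ℓ s + rescale b v ℓ t := by
  induction ℓ with
  | zero =>
    obtain rfl : i = 0 := by omega
    simp [rescale, hv0]
  | succ ℓ ih =>
    rcases hi.lt_or_eq with hlt | rfl
    · have := ih (by omega) (by omega)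
      have := rescale_le_succ hb hv0 hv hℓ s
      have := rescale_le_succ hb hv0 hv hℓ t
      linarith
    have hs0 := (rescale_bounds hb hv0 hv hℓ s).1
    have ht0 := (rescale_bounds hb hv0 hv hℓ t).1
    rcases le_or_gt (b (ℓ + 1)) s with h | h
    · rw [rescale_of_le h]; linarith
    rcases le_or_gt (b (ℓ + 1)) t with h' | h'
    · rw [rescale_of_le h']; linarith
    clear ih
    wlog hts : t ≤ s generalizing s t
    · rw [add_comm (rescale b v _ s)]
      exact this (by omega) ht0 hs0 h' h (by omega)
    obtain ⟨m, hm⟩ := hodd (ℓ + 1)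
    have hs : b (ℓ + 1) < 2 * s := by omega
    rw [rescale_of_lt_two_mul h hs]
    rcases lt_or_ge (b (ℓ + 1)) (2 * t) with ht | ht
    · rw [rescale_of_lt_two_mul h' ht]
      have h₁ := le_max_right (v ℓ) (v (ℓ + 1) - rescale b v ℓ (b (ℓ + 1) - s))
      have h₂ := le_max_left (v ℓ) (v (ℓ + 1) - rescale b v ℓ (b (ℓ + 1) - t))
      have h₃ := (rescale_bounds hb hv0 hv (ℓ := ℓ) (by omega) (b (ℓ + 1) - s)).2
      linarith
    · rw [rescale_of_two_mul_le (hb _) ht]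
      have h₁ := le_max_right (v ℓ) (v (ℓ + 1) - rescale b v ℓ (b (ℓ + 1) - s))
      have h₂ := rescale_mono hb hv0 hv (ℓ := ℓ) (by omega) (show b (ℓ + 1) - s ≤ t by omega)
      linarith

/-- When `s + t` is exactly `b (i + 1)` the mirror term cancels, leaving `v (i + 1)`; the floor
branch gives at most `2 * v i`, the source of the factor `2`. Doubling of `b` makes higher levels
irrelevant. -/
lemma rescale_add_rescale_le (hb : ∀ i, 0 < b i) (hodd : ∀ i, Odd (b i))
    (hb2 : ∀ i, 2 * b i ≤ b (i + 1)) (hv0 : v 0 = 0) (hv : ∀ i < k, v i ≤ v (i + 1))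
    (hℓ : ℓ ≤ k) (hi : i + 1 ≤ ℓ) (hs : 0 ≤ s) (ht : 0 ≤ t) (hst : s + t = b (i + 1)) :
    rescale b v ℓ s + rescale b v ℓ t ≤ max (v (i + 1)) (2 * v i) := by
  induction ℓ with
  | zero => omega
  | succ ℓ ih =>
    rcases hi.lt_or_eq with hlt | heq
    · have hbi : 2 * b (i + 1) ≤ b (ℓ + 1) := by
        have : Monotone b := monotone_nat_of_le_succ fun j => by linarith [hb2 j, hb j]
        exact (hb2 (i + 1)).trans (this (by omega))
      rw [rescale_of_two_mul_le (hb _) (by omega), rescale_of_two_mul_le (hb _) (by omega)]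
      exact ih (by omega) (by omega)
    obtain rfl : i = ℓ := by omega
    clear ih
    wlog hts : t ≤ s generalizing s t
    · rw [add_comm (rescale b v _ s)]
      exact this ht hs (by omega) (by omega)
    obtain ⟨m, hm⟩ := hodd (i + 1)
    rcases le_or_gt (b (i + 1)) s with h | h
    · rw [rescale_of_le h, rescale_of_nonpos (u := t) hb (by omega), add_zero]
      exact le_max_left _ _
    rw [rescale_of_lt_two_mul h (by omega), rescale_of_two_mul_le (u := t) (hb _) (by omega),
      ← hst, add_sub_cancel_left, max_add]
    refine max_le (le_max_of_le_right ?_) (le_max_of_le_left (by linarith))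
    have := (rescale_bounds hb hv0 hv (ℓ := i) (by omega) t).2
    linarith

end Rescale

end LexMax
-- Level counts and the approximation bound.
namespace LexMax

/-- The number of elements of `X` at level `ℓ`. -/
def levelCount {E : Type*} (c : E → ℕ) (X : Finset E) (ℓ : ℕ) : ℕ :=
  (X.filter fun e => c e = ℓ).card

/-- Lexicographic comparison of level counts, higher levels first. -/
def LevelLarger {E : Type*} (c : E → ℕ) (X Y : Finset E) : Prop :=
  ∃ ℓ, (∀ m, ℓ < m → levelCount c X m = levelCount c Y m) ∧ levelCount c Y ℓ < levelCount c X ℓ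

section Level

variable {E : Type*} {c : E → ℕ} {k : ℕ} {X Y : Finset E}

lemma levelCount_eq_zero (hc : ∀ e, c e ≤ k) {ℓ : ℕ} (hℓ : k < ℓ) : levelCount c X ℓ = 0 := by
  rw [levelCount, Finset.card_eq_zero, Finset.filter_eq_empty_iff]
  intro e _ he
  have := hc e
  omega

lemma sum_eq_sum_levelCount {R : Type*} [CommSemiring R] (hc : ∀ e, c e ≤ k) (f : ℕ → R) :
    ∑ e ∈ X, f (c e) = ∑ ℓ ∈ Finset.range (k + 1), levelCount c X ℓ * f ℓ := by
  rw [← Finset.sum_fiberwise_of_maps_to (t := Finset.range (k + 1)) (g := c)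
    (fun e _ => Finset.mem_range.2 (Nat.lt_succ_of_le (hc e)))]
  refine Finset.sum_congr rfl fun ℓ _ => ?_
  rw [Finset.sum_congr rfl fun e he => by rw [(Finset.mem_filter.1 he).2], Finset.sum_const,
    nsmul_eq_mul, levelCount]

lemma LevelLarger.sum_lt [Fintype E] (hc : ∀ e, c e ≤ k) {N : ℤ} (hN : (Fintype.card E : ℤ) < N)
    (h : LevelLarger c X Y) : ∑ e ∈ Y, N ^ c e < ∑ e ∈ X, N ^ c e := by
  obtain ⟨ℓ, hgt, hlt⟩ := h
  have hN0 : 0 < N := lt_of_le_of_lt (Int.natCast_nonneg _) hN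
  have hℓ : ℓ ≤ k := by
    by_contra hk
    rw [levelCount_eq_zero (X := X) hc (not_le.1 hk)] at hlt
    omega
  rw [sum_eq_sum_levelCount hc (fun m => N ^ m), sum_eq_sum_levelCount hc (fun m => N ^ m),
    ← Finset.sum_range_add_sum_Ico _ (show ℓ + 1 ≤ k + 1 by omega),
    ← Finset.sum_range_add_sum_Ico (fun m => (levelCount c X m : ℤ) * N ^ m)
      (show ℓ + 1 ≤ k + 1 by omega)]
  have htop : ∑ m ∈ Finset.Ico (ℓ + 1) (k + 1), (levelCount c Y m : ℤ) * N ^ m =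
      ∑ m ∈ Finset.Ico (ℓ + 1) (k + 1), (levelCount c X m : ℤ) * N ^ m :=
    Finset.sum_congr rfl fun m hm => by rw [hgt m (by have := (Finset.mem_Ico.1 hm).1; omega)]
  -- Level counts are digits in base `N`: all levels below `j` together weigh less than `N ^ j`.
  have hlow : ∀ j, ∑ m ∈ Finset.range j, (levelCount c Y m : ℤ) * N ^ m < N ^ j := by
    intro j
    induction j with
    | zero => simp
    | succ j ih =>
      have : (levelCount c Y j : ℤ) ≤ N - 1 := by
        have : levelCount c Y j ≤ Fintype.card E := Finset.card_le_univ _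
        omega
      rw [Finset.sum_range_succ, pow_succ']
      nlinarith [pow_pos hN0 j]
  have hnn : 0 ≤ ∑ m ∈ Finset.range ℓ, (levelCount c X m : ℤ) * N ^ m :=
    Finset.sum_nonneg fun m _ => by positivity
  have hmid : (levelCount c Y ℓ : ℤ) * N ^ ℓ + N ^ ℓ ≤ levelCount c X ℓ * N ^ ℓ := by
    have : (levelCount c Y ℓ : ℤ) + 1 ≤ levelCount c X ℓ := by exact_mod_cast hlt
    nlinarith [pow_pos hN0 ℓ]
  rw [htop, Finset.sum_range_succ, Finset.sum_range_succ]
  linarith [hlow ℓ]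

lemma levelLarger_or_of_ne (hc : ∀ e, c e ≤ k) {m : ℕ} (h : levelCount c X m ≠ levelCount c Y m) :
    LevelLarger c X Y ∨ LevelLarger c Y X := by
  let S := (Finset.range (k + 1)).filter fun m => levelCount c X m ≠ levelCount c Y m
  have hS : ∀ m, levelCount c X m ≠ levelCount c Y m → m ∈ S := fun m hm => by
    refine Finset.mem_filter.2 ⟨Finset.mem_range.2 ?_, hm⟩
    by_contra hk
    exact hm (by rw [levelCount_eq_zero hc (by omega), levelCount_eq_zero hc (by omega)])
  have hne : S.Nonempty := ⟨m, hS m h⟩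
  have hgt : ∀ m, S.max' hne < m → levelCount c X m = levelCount c Y m := fun m hm => by
    by_contra hcon
    exact (S.le_max' m (hS m hcon)).not_gt hm
  rcases lt_or_gt_of_ne (Finset.mem_filter.1 (S.max'_mem hne)).2 with h | h
  · exact .inr ⟨_, fun m hm => (hgt m hm).symm, h⟩
  · exact .inl ⟨_, hgt, h⟩

/-- A common independent set with lexicographically maximal level counts has at least `κ` times
the weight of any other, for level weights `v` satisfying `v i ≤ v (i + 1)` and
`2 * κ * v i ≤ v (i + 1)`. -/
theorem mul_sum_le_of_levelMaximal [Fintype E] {M₁ M₂ : Matroid E} (hc₁ : ∀ e, 1 ≤ c e)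
    (hc : ∀ e, c e ≤ k) {v : ℕ → ℝ} (hv0 : v 0 = 0) (hv : ∀ i < k, v i ≤ v (i + 1))
    {κ : ℝ} (hκ0 : 0 ≤ κ) (hκ1 : κ ≤ 1) (hκ : ∀ i < k, 2 * κ * v i ≤ v (i + 1))
    (hX : X ∈ commonIndep M₁ M₂) (hmax : ∀ Y ∈ commonIndep M₁ M₂, ¬ LevelLarger c Y X)
    (hY : Y ∈ commonIndep M₁ M₂) : κ * ∑ e ∈ Y, v (c e) ≤ ∑ e ∈ X, v (c e) := by
  -- Larger than every level count, so that weight order refines lex order; odd, so that no integer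
  -- is half a power; at least `2`, for doubling.
  set N : ℤ := 2 * Fintype.card E + 3 with hN
  have hNlt : (Fintype.card E : ℤ) < N := by omega
  have hN3 : 3 ≤ N := by omega
  have hb : ∀ i : ℕ, 0 < N ^ i := fun i => pow_pos (by omega) i
  have hodd : ∀ i : ℕ, Odd (N ^ i) := fun i => Odd.pow ⟨Fintype.card E + 1, by omega⟩
  have hb2 : ∀ i : ℕ, 2 * N ^ i ≤ N ^ (i + 1) := fun i => by
    rw [pow_succ']
    nlinarith [hb i]
  have hopt : ∀ Z ∈ commonIndep M₁ M₂, ∑ e ∈ Z, N ^ c e ≤ ∑ e ∈ X, N ^ c e := fun Z hZ => by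
    by_cases hcnt : ∀ m, levelCount c Z m = levelCount c X m
    · rw [sum_eq_sum_levelCount hc (fun m => N ^ m), sum_eq_sum_levelCount hc (fun m => N ^ m)]
      simp [hcnt]
    · push Not at hcnt
      obtain ⟨m, hm⟩ := hcnt
      exact ((levelLarger_or_of_ne hc hm).resolve_left (hmax Z hZ)).sum_lt hc hNlt |>.le
  obtain ⟨w₁, w₂, hw, hnn, hsplit⟩ := exists_weight_splitting (fun e => N ^ c e) hX hopt
  let φ := rescale (fun i => N ^ i) v k
  obtain ⟨h₁, h₂⟩ := hsplit φ (rescale_mono hb hv0 hv le_rfl) (rescale_of_nonpos hb le_rfl)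
    (fun u => (rescale_bounds hb hv0 hv le_rfl u).1) Y hY
  have hcover : ∑ e ∈ Y, v (c e) ≤ ∑ e ∈ Y, (φ (w₁ e) + φ (w₂ e)) :=
    Finset.sum_le_sum fun e _ => le_rescale_add_rescale hb hodd hv0 hv le_rfl (hc e) (hw e).ge
  -- Only on `X` are both parts known to be nonnegative, as the upper bound requires.
  have htight : ∑ e ∈ X, κ * (φ (w₁ e) + φ (w₂ e)) ≤ ∑ e ∈ X, v (c e) := by
    refine Finset.sum_le_sum fun e he => ?_
    obtain ⟨i, hi⟩ := Nat.exists_eq_add_of_le' (hc₁ e)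
    have hik : i < k := by have := hc e; omega
    have := rescale_add_rescale_le hb hodd hb2 hv0 hv le_rfl (hi ▸ hc e) (hnn e he).1
      (hnn e he).2 (by rw [hw e, hi])
    have hvi : 0 ≤ v (i + 1) :=
      (rescale_bounds hb hv0 hv (show i + 1 ≤ k from hik) 0).1.trans
        (rescale_bounds hb hv0 hv hik 0).2
    rw [hi]
    calc κ * (φ (w₁ e) + φ (w₂ e)) ≤ κ * max (v (i + 1)) (2 * v i) := by gcongr
      _ = max (κ * v (i + 1)) (κ * (2 * v i)) := mul_max_of_nonneg _ _ hκ0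
      _ ≤ v (i + 1) := max_le (mul_le_of_le_one_left hvi hκ1) (by linarith [hκ i hik])
  rw [← Finset.mul_sum] at htight
  refine le_trans ?_ htight
  gcongr
  refine hcover.trans ?_
  rw [Finset.sum_add_distrib, Finset.sum_add_distrib]
  exact add_le_add h₁ h₂

end Level

end LexMax
-- From levels back to the weights `w`.
namespace LexMax

lemma empty_mem_commonIndep {E : Type*} {M₁ M₂ : Matroid E} : ∅ ∈ commonIndep M₁ M₂ := by
  simp [commonIndep]

section Levels

variable {E : Type*} [Fintype E] {w : E → ℝ} {F : Set (Finset E)} {M₁ M₂ : Matroid E}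
  {X Y : Finset E}

/-- The `ℓ`-th smallest value of `w`, with `levelWeight w 0 = 0`. -/
noncomputable def levelWeight (w : E → ℝ) (ℓ : ℕ) : ℝ :=
  if h : 0 < ℓ ∧ ℓ ≤ numValues w then
    (values w).orderEmbOfFin rfl ⟨ℓ - 1, (Nat.sub_lt h.1 one_pos).trans_le h.2⟩ else 0

lemma levelWeight_succ {i : ℕ} (hi : i < numValues w) :
    levelWeight w (i + 1) = (values w).orderEmbOfFin rfl ⟨i, hi⟩ := by
  rw [levelWeight, dif_pos ⟨i.succ_pos, hi⟩]
  rfl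

lemma exists_orderEmbOfFin_eq (w : E → ℝ) (e : E) :
    ∃ j, (values w).orderEmbOfFin rfl j = w e := by
  have : w e ∈ Set.range ((values w).orderEmbOfFin rfl) := by
    rw [Finset.range_orderEmbOfFin]
    simp [values]
  exact this

/-- The level of `e`: the position of `w e` among the values of `w` in ascending order. -/
noncomputable def level (w : E → ℝ) (e : E) : ℕ := (exists_orderEmbOfFin_eq w e).choose + 1

lemma one_le_level (e : E) : 1 ≤ level w e := Nat.le_add_left _ _

lemma level_le (e : E) : level w e ≤ numValues w := (exists_orderEmbOfFin_eq w e).choose.isLt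

lemma levelWeight_level (e : E) : levelWeight w (level w e) = w e := by
  rw [level, levelWeight_succ (Fin.isLt _)]
  exact (exists_orderEmbOfFin_eq w e).choose_spec

lemma weight_eq : weight w X = ∑ e ∈ X, levelWeight w (level w e) := by
  simp only [weight, levelWeight_level]

/-- `value` descends from index `0` while `level` ascends from `1`, hence the reflection. -/
lemma eq_value_iff {e : E} {i : Fin (numValues w)} :
    w e = value w i ↔ level w e = numValues w - i := by
  have h := (exists_orderEmbOfFin_eq w e).choose_spec
  rw [level]
  generalize (exists_orderEmbOfFin_eq w e).choose = j at h
  rw [value, ← h, EmbeddingLike.apply_eq_iff_eq, Fin.ext_iff, Fin.val_rev]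
  have : (i : ℕ) < (values w).card := i.isLt
  change _ ↔ (j : ℕ) + 1 = (values w).card - i
  omega

lemma card_layer (i : Fin (numValues w)) :
    (layer w X i).card = levelCount (level w) X (numValues w - i) := by
  rw [layer, levelCount]
  congr 1
  ext e
  simp only [Finset.mem_filter, eq_value_iff]

lemma lexLarger_iff : LexLarger w X Y ↔ LevelLarger (level w) X Y := by
  constructor
  · rintro ⟨i, heq, hlt⟩
    rw [card_layer, card_layer] at hlt
    refine ⟨_, fun m hm => ?_, hlt⟩
    by_cases hk : numValues w < m
    · rw [levelCount_eq_zero level_le hk, levelCount_eq_zero level_le hk]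
    · have hi := i.isLt
      have := heq ⟨numValues w - m, by omega⟩ (Fin.lt_def.2 (by simp only; omega))
      rw [card_layer, card_layer] at this
      simpa only [show numValues w - (numValues w - m) = m by omega] using this
  · rintro ⟨ℓ, heq, hlt⟩
    obtain ⟨e, he⟩ := Finset.card_pos.1 (Nat.zero_lt_of_lt hlt)
    have he := (Finset.mem_filter.1 he).2
    have h₁ := one_le_level (w := w) e
    have h₂ := level_le (w := w) e
    refine ⟨⟨numValues w - ℓ, by omega⟩, fun j hj => ?_, ?_⟩
    · rw [card_layer, card_layer]
      have := Fin.lt_def.1 hj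
      exact heq _ (by simp only at this; omega)
    · rw [card_layer, card_layer]
      simpa only [show numValues w - (numValues w - ℓ) = ℓ by omega] using hlt

lemma levelWeight_pos (hw : ∀ e, 0 < w e) {i : ℕ} (hi : i < numValues w) :
    0 < levelWeight w (i + 1) := by
  rw [levelWeight_succ hi]
  have h := (values w).orderEmbOfFin_mem rfl ⟨i, hi⟩
  obtain ⟨e, -, he⟩ := Finset.mem_image.1 h
  rw [← he]
  exact hw e

lemma levelWeight_zero : levelWeight w 0 = 0 := by simp [levelWeight]

lemma levelWeight_le_succ (hw : ∀ e, 0 < w e) {i : ℕ} (hi : i < numValues w) :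
    levelWeight w i ≤ levelWeight w (i + 1) := by
  rcases i with _ | i
  · rw [levelWeight_zero]
    exact (levelWeight_pos hw hi).le
  · rw [levelWeight_succ hi, levelWeight_succ (by omega)]
    exact ((values w).orderEmbOfFin rfl).monotone (by simp [Fin.le_def])

lemma minRatio_mul_levelWeight_le (hw : ∀ e, 0 < w e) {i : ℕ} (hi : i < numValues w) :
    minRatio w * levelWeight w i ≤ levelWeight w (i + 1) := by
  rcases i with _ | i
  · rw [levelWeight_zero, mul_zero]
    exact (levelWeight_pos hw hi).le
  · have hle : minRatio w ≤ levelWeight w (i + 1 + 1) / levelWeight w (i + 1) := by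
      have := ciInf_le (Set.finite_range fun j : Fin (numValues w - 1) =>
        value w ⟨j.val, by have := j.isLt; omega⟩ /
          value w ⟨j.val + 1, by have := j.isLt; omega⟩).bddBelow
        -- The descending index of level `i + 2`; the next index is level `i + 1`.
        ⟨numValues w - 2 - i, by omega⟩
      refine this.trans_eq ?_
      rw [levelWeight_succ hi, levelWeight_succ (by omega), value, value]
      congr 3
      · simp only [Fin.ext_iff, Fin.val_rev]; omega
      · simp only [Fin.ext_iff, Fin.val_rev]; omega
    rwa [le_div_iff₀ (levelWeight_pos hw (by omega))] at hle

lemma exists_isLexMaximal (w : E → ℝ) (hF : F.Nonempty) : ∃ X, IsLexMaximal w F X := by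
  obtain ⟨X, hX, hmax⟩ := Set.exists_max_image F
    (fun X => ∑ e ∈ X, ((Fintype.card E : ℤ) + 1) ^ level w e) (Set.toFinite F) hF
  exact ⟨X, hX, fun Y hY h =>
    ((lexLarger_iff.1 h).sum_lt level_le (lt_add_one _)).not_ge (hmax Y hY)⟩

lemma exists_isMaxWeight (w : E → ℝ) (hF : F.Nonempty) : ∃ X, IsMaxWeight w F X :=
  Set.exists_max_image F (weight w) (Set.toFinite F) hF

lemma IsLexMaximal.mul_weight_le (hw : ∀ e, 0 < w e) {κ : ℝ} (hκ0 : 0 ≤ κ) (hκ1 : κ ≤ 1)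
    (hκ : 2 * κ ≤ minRatio w) (hX : IsLexMaximal w (commonIndep M₁ M₂) X)
    (hY : Y ∈ commonIndep M₁ M₂) : κ * weight w Y ≤ weight w X := by
  rw [weight_eq, weight_eq]
  refine mul_sum_le_of_levelMaximal one_le_level level_le levelWeight_zero
    (fun i hi => levelWeight_le_succ hw hi) hκ0 hκ1 (fun i hi => ?_) hX.1
    (fun Z hZ h => hX.2 Z hZ (lexLarger_iff.2 h)) hY
  refine le_trans ?_ (minRatio_mul_levelWeight_le hw hi)
  gcongr
  rcases i with _ | i
  · exact levelWeight_zero.ge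
  · exact (levelWeight_pos hw (by omega)).le

/-- If consecutive weights differ by a factor more than `2`, then a maximum-weight common
independent set has the level counts of a lex-maximal one: otherwise decreasing the weight of the
highest level on which they differ contradicts the optimality of the lex-maximal set. -/
lemma IsLexMaximal.levelCount_eq (hw : ∀ e, 0 < w e) (hα : 2 < minRatio w)
    (hX : IsLexMaximal w (commonIndep M₁ M₂) X) (hY : IsMaxWeight w (commonIndep M₁ M₂) Y)
    (m : ℕ) : levelCount (level w) X m = levelCount (level w) Y m := by
  by_contra hm
  have hXmax : ∀ Z ∈ commonIndep M₁ M₂, ¬ LevelLarger (level w) Z X := fun Z hZ h =>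
    hX.2 Z hZ (lexLarger_iff.2 h)
  obtain ⟨ℓ, -, hlt⟩ := (levelLarger_or_of_ne level_le hm).resolve_right (hXmax Y hY.1)
  obtain ⟨e, he⟩ := Finset.card_pos.1 (Nat.zero_lt_of_lt hlt)
  have he := (Finset.mem_filter.1 he).2
  obtain ⟨j, rfl⟩ := Nat.exists_eq_add_of_le' (he ▸ one_le_level e)
  have hj : j < numValues w := he.symm.trans_le (level_le e)
  have hnn : ∀ i ≤ numValues w, 0 ≤ levelWeight w i := fun i hi => by
    rcases i with _ | i
    · exact levelWeight_zero.ge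
    · exact (levelWeight_pos hw hi).le
  have h2 : ∀ i < numValues w, 2 * levelWeight w i ≤ levelWeight w (i + 1) := fun i hi =>
    (mul_le_mul_of_nonneg_right hα.le (hnn i hi.le)).trans (minRatio_mul_levelWeight_le hw hi)
  have hstrict : 2 * levelWeight w j < levelWeight w (j + 1) := by
    rcases j with _ | j
    · simpa [levelWeight_zero] using levelWeight_pos hw hj
    · exact (mul_lt_mul_of_pos_right hα (levelWeight_pos hw (by omega))).trans_le
        (minRatio_mul_levelWeight_le hw hj)
  -- The lowest value that keeps a ratio of at least `2` to the level below; lowering it only helps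
  -- the level above.
  let v := Function.update (levelWeight w) (j + 1) (2 * levelWeight w j)
  have hv : ∀ i, v i ≤ levelWeight w i := fun i => by
    by_cases hi : i = j + 1
    · subst hi; simpa [v] using hstrict.le
    · simp [v, hi]
  have hv2 : ∀ i < numValues w, 2 * v i ≤ v (i + 1) := fun i hi => by
    by_cases hij : i = j
    · subst hij; simp [v]
    · calc 2 * v i ≤ 2 * levelWeight w i := by linarith [hv i]
        _ ≤ levelWeight w (i + 1) := h2 i hi
        _ = v (i + 1) := by simp [v, hij]
  have hvnn : ∀ i ≤ numValues w, 0 ≤ v i := fun i hi => by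
    by_cases hij : i = j + 1
    · subst hij; simpa [v] using hnn j hj.le
    · simpa [v, hij] using hnn i hi
  have key := mul_sum_le_of_levelMaximal (v := v) (κ := 1) one_le_level level_le
    (by simp [v, levelWeight_zero]) (fun i hi => by linarith [hv2 i hi, hvnn i hi.le])
    zero_le_one le_rfl (fun i hi => by linarith [hv2 i hi]) hX.1 hXmax hY.1
  have hYX := hY.2 X hX.1
  have hdiff : ∀ Z : Finset E, ∑ e ∈ Z, v (level w e) = weight w Z -
      levelCount (level w) Z (j + 1) * (levelWeight w (j + 1) - 2 * levelWeight w j) := by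
    intro Z
    rw [weight_eq, levelCount, ← nsmul_eq_mul, ← Finset.sum_const, Finset.sum_filter,
      ← Finset.sum_sub_distrib]
    refine Finset.sum_congr rfl fun e _ => ?_
    by_cases he : level w e = j + 1
    · simp [v, he]
    · simp [v, he]
  rw [one_mul, hdiff, hdiff] at key
  have : (levelCount (level w) Y (j + 1) : ℝ) < levelCount (level w) X (j + 1) := by
    exact_mod_cast hlt
  -- The change costs `X` strictly more than `Y`, though `X` was no heavier to begin with,
  -- contradicting `key`.
  nlinarith

lemma isLexMaximal_iff_isMaxWeight (hw : ∀ e, 0 < w e) (hα : 2 < minRatio w) :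
    IsLexMaximal w (commonIndep M₁ M₂) X ↔ IsMaxWeight w (commonIndep M₁ M₂) X := by
  refine ⟨fun hX => ⟨hX.1, fun Y hY => ?_⟩, fun hX => ⟨hX.1, fun Y hY hlarger => ?_⟩⟩
  · simpa using hX.mul_weight_le hw zero_le_one le_rfl (by linarith) hY
  -- `X` has the level counts of a lex-maximal `Z`, so a set lex-larger than `X` would be lex-larger
  -- than `Z`.
  · obtain ⟨Z, hZ⟩ := exists_isLexMaximal w ⟨∅, empty_mem_commonIndep (M₁ := M₁) (M₂ := M₂)⟩
    refine hZ.2 Y hY (lexLarger_iff.2 ?_)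
    obtain ⟨ℓ, heq, hlt⟩ := lexLarger_iff.1 hlarger
    have hcount := hZ.levelCount_eq hw hα hX
    exact ⟨ℓ, fun m hm => by rw [heq m hm, hcount], by rwa [hcount]⟩

end Levels

end LexMax
theorem theorem2 {E : Type*} [Fintype E] (M₁ M₂ : Matroid E)
    (hM₁ : M₁.E = Set.univ) (hM₂ : M₂.E = Set.univ)
    (w : E → ℝ) (hw : ∀ e, 0 < w e) (hk : 2 ≤ LexMax.numValues w) :
    (∃ X, LexMax.IsLexMaximal w (LexMax.commonIndep M₁ M₂) X) ∧
    (∃ Y, LexMax.IsMaxWeight w (LexMax.commonIndep M₁ M₂) Y) ∧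
    (LexMax.minRatio w ≤ 2 →
      ∀ X Y, LexMax.IsLexMaximal w (LexMax.commonIndep M₁ M₂) X →
        LexMax.IsMaxWeight w (LexMax.commonIndep M₁ M₂) Y →
          LexMax.minRatio w / 2 * LexMax.weight w Y ≤ LexMax.weight w X) ∧
    (2 < LexMax.minRatio w →
      ∀ X, LexMax.IsLexMaximal w (LexMax.commonIndep M₁ M₂) X ↔
        LexMax.IsMaxWeight w (LexMax.commonIndep M₁ M₂) X) := by
  have hne : (LexMax.commonIndep M₁ M₂).Nonempty := ⟨∅, LexMax.empty_mem_commonIndep⟩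
  refine ⟨LexMax.exists_isLexMaximal w hne, LexMax.exists_isMaxWeight w hne,
    fun hα X Y hX hY => ?_, fun hα X => LexMax.isLexMaximal_iff_isMaxWeight hw hα⟩
  -- For a negative ratio the bound is trivial, so positivity of the infimum need not be shown.
  rcases le_or_gt 0 (LexMax.minRatio w) with h0 | h0
  · exact hX.mul_weight_le hw (by linarith) (by linarith) (by linarith) hY.1
  · have hnn : ∀ Z : Finset E, 0 ≤ LexMax.weight w Z := fun Z =>
      Finset.sum_nonneg fun e _ => (hw e).le
    nlinarith [hnn X, hnn Y]
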